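/- Throughout, an operator space is a linear subspace $E\subseteq \mathcal B(H)$, $H$ a complex Hilbert space, with the norms on $M_n(E)\subseteq M_n(\mathcal B(H))=\mathcal B(H^n)$, $n\ge 1$. A linear map $\varphi\colon E\to F$ of operator spaces is completely contractive (completely isometric) if all its amplifications $M_n(E)\to M_n(F)$ are contractive (isometric). An operator space $F$ is injective if for all operator spaces $A\subseteq B$ every completely contractive map $A\to F$ extends to a completely contractive map $B\to F$. An injective envelope of $E$ is a pair $(F,\kappa)$ where $F$ is an injective operator space, $\kappa\colon E\to F$ is completely isometric, and the only injective operator space $F_0$ with $\kappa(E)\subseteq F_0\subseteq F$ is $F_0=F$. Theorem. Every operator space has an injective envelope. More precisely, let $H$ be a complex Hilbert space, let $E\subseteq\mathcal B(H)$ be an operator space, and let $\mathcal S$ be the set of completely contractive linear maps $\varphi\colon\mathcal B(H)\to\mathcal B(H)$ with $\varphi(x)=x$ for all $x\in E$, with composition as multiplication and with the topology of pointwise weak* convergence ($\mathcal B(H)$ being the dual of the trace class operators). Then: (1) $\mathcal S$ is a compact affine right topological semigroup, that is, a nonempty compact convex subset of a Hausdorff locally convex space, closed under multiplication, such that for each $t\in\mathcal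 S$ the map $s\mapsto st$ on $\mathcal S$ is continuous and affine. (2) $\mathcal S$ contains a minimal idempotent, that is, a minimal element of the set of idempotents of $\mathcal S$ for the partial order $e\preceq f\iff ef=fe=e$. (3) For every minimal idempotent $\varphi$ of $\mathcal S$, the space $\varphi(\mathcal B(H))$ contains $E$ and, with the inclusion map, is an injective envelope of $E$. (4) Conversely, if $E\subseteq F\subseteq\mathcal B(H)$ and $F$, with the inclusion map, is an injective envelope of $E$, then $F=\varphi(\mathcal B(H))$ for some minimal idempotent $\varphi$ of $\mathcal S$. -/

import Mathlib

universe u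

namespace InjectiveEnvelope

section Matrices

variable {H : Type*} [NormedAddCommGroup H] [InnerProductSpace ℂ H]

/-- The canonical identification `M_n(B(H)) = B(Hⁿ)`: the operator on the `ℓ²`-direct sum `Hⁿ`
given by an `n × n` matrix of bounded operators on `H`. -/
noncomputable def matrixOp {n : ℕ} (a : Matrix (Fin n) (Fin n) (H →L[ℂ] H)) :
    PiLp 2 (fun _ : Fin n => H) →L[ℂ] PiLp 2 (fun _ : Fin n => H) :=
  ((PiLp.continuousLinearEquiv 2 ℂ (fun _ : Fin n => H)).symm :
      (Fin n → H) →L[ℂ] PiLp 2 (fun _ : Fin n => H)) ∘L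
    ContinuousLinearMap.pi fun i => ∑ j, a i j ∘L PiLp.proj 2 (fun _ : Fin n => H) j

theorem matrixOp_apply {n : ℕ} (a : Matrix (Fin n) (Fin n) (H →L[ℂ] H))
    (x : PiLp 2 (fun _ : Fin n => H)) (i : Fin n) :
    matrixOp a x i = ∑ j, a i j (x j) := by
  simp [matrixOp]

end Matrices

section OperatorSpaces

/-! An operator space is a linear subspace `E` of `B(H)`, with `H` a complex Hilbert space; the
norm on `M_n(E)` is the one of `M_n(B(H)) = B(Hⁿ)`. -/

variable {H : Type*} [NormedAddCommGroup H] [InnerProductSpace ℂ H]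
  {K : Type*} [NormedAddCommGroup K] [InnerProductSpace ℂ K]

/-- The linear map `φ : E → F` of operator spaces is completely contractive. -/
def CompletelyContractive {E : Submodule ℂ (H →L[ℂ] H)} {F : Submodule ℂ (K →L[ℂ] K)}
    (φ : E →ₗ[ℂ] F) : Prop :=
  ∀ (n : ℕ) (a : Matrix (Fin n) (Fin n) E),
    ‖matrixOp (a.map fun x => (φ x : K →L[ℂ] K))‖ ≤ ‖matrixOp (a.map fun x => (x : H →L[ℂ] H))‖

/-- The linear map `φ : E → F` of operator spaces is completely isometric. -/
def CompletelyIsometric {E : Submodule ℂ (H →L[ℂ] H)} {F : Submodule ℂ (K →L[ℂ] K)}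
    (φ : E →ₗ[ℂ] F) : Prop :=
  ∀ (n : ℕ) (a : Matrix (Fin n) (Fin n) E),
    ‖matrixOp (a.map fun x => (φ x : K →L[ℂ] K))‖ = ‖matrixOp (a.map fun x => (x : H →L[ℂ] H))‖

end OperatorSpaces

section Injectivity

variable {K : Type u} [NormedAddCommGroup K] [InnerProductSpace ℂ K]

/-- `F` is an injective object in the category of operator spaces and completely contractive
maps: for all operator spaces `A ⊆ B`, every completely contractive map `A → F` extends to a
completely contractive map `B → F`. -/
def IsInjective (F : Submodule ℂ (K →L[ℂ] K)) : Prop :=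
  ∀ (L : Type u) [NormedAddCommGroup L] [InnerProductSpace ℂ L] [CompleteSpace L]
    (A B : Submodule ℂ (L →L[ℂ] L)) (hAB : A ≤ B) (φ : A →ₗ[ℂ] F), CompletelyContractive φ →
    ∃ φ' : B →ₗ[ℂ] F, CompletelyContractive φ' ∧ ∀ x : A, φ' (Submodule.inclusion hAB x) = φ x

variable {H : Type u} [NormedAddCommGroup H] [InnerProductSpace ℂ H]

/-- `(F, κ)` is an injective envelope of `E`. -/
structure IsInjectiveEnvelope (E : Submodule ℂ (H →L[ℂ] H)) (F : Submodule ℂ (K →L[ℂ] K))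
    (κ : E →ₗ[ℂ] F) : Prop where
  completelyIsometric : CompletelyIsometric κ
  injective : IsInjective F
  minimal : ∀ F₀ : Submodule ℂ (K →L[ℂ] K), (∀ x : E, (κ x : K →L[ℂ] K) ∈ F₀) → F₀ ≤ F →
    IsInjective F₀ → F₀ = F

/-- `E` has an injective envelope. -/
def HasInjectiveEnvelope (E : Submodule ℂ (H →L[ℂ] H)) : Prop :=
  ∃ (L : Type u) (_ : NormedAddCommGroup L) (_ : InnerProductSpace ℂ L) (_ : CompleteSpace L)
    (F : Submodule ℂ (L →L[ℂ] L)) (κ : E →ₗ[ℂ] F), IsInjectiveEnvelope E F κ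

end Injectivity

section Semigroups

/-- `e` is a minimal idempotent of the semigroup `S`, i.e. a minimal element of the set of
idempotents of `S` under the order `e ≼ f ↔ e * f = e ∧ f * e = e`. -/
structure IsMinimalIdempotent {M : Type*} [Mul M] (S : Set M) (f : M) : Prop where
  mem : f ∈ S
  idem : f * f = f
  minimal : ∀ e ∈ S, e * e = e → e * f = e → f * e = e → e = f

/-- `S`, with the multiplication of `V`, is a compact affine right topological semigroup: a
nonempty compact convex subset of a Hausdorff locally convex topological vector space, closed
under multiplication, such that each right multiplication `s ↦ s * t` is affine and continuous
on `S`. -/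
structure IsCompactAffineRightTopologicalSemigroup {V : Type*} [AddCommGroup V] [Module ℝ V]
    [Semigroup V] (τ : TopologicalSpace V) (S : Set V) : Prop where
  isTopologicalAddGroup : IsTopologicalAddGroup V
  continuousSMul : ContinuousSMul ℝ V
  locallyConvexSpace : LocallyConvexSpace ℝ V
  t2Space : T2Space V
  nonempty : S.Nonempty
  convex : Convex ℝ S
  isCompact : IsCompact S
  mul_mem : ∀ s ∈ S, ∀ t ∈ S, s * t ∈ S
  continuousOn_mul_right : ∀ t ∈ S, ContinuousOn (fun s => s * t) S
  affine_mul_right : ∀ t ∈ S, ∀ s ∈ S, ∀ s' ∈ S, ∀ a b : ℝ, 0 ≤ a → 0 ≤ b → a + b = 1 →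
    (a • s + b • s') * t = a • (s * t) + b • (s' * t)

end Semigroups

section Maps

variable {H : Type*} [NormedAddCommGroup H] [InnerProductSpace ℂ H]

/-- The functional `a ↦ ∑ₖ ⟨a xₖ, yₖ⟩` on `B(H)`, for square-summable sequences `x`, `y` in `H`.
These are exactly the functionals in the predual of `B(H)`. -/
noncomputable def normalFunctional (x y : lp (fun _ : ℕ => H) 2) (a : H →L[ℂ] H) : ℂ :=
  ∑' k, inner ℂ (y k) (a (x k))

theorem summable_normalFunctional (x y : lp (fun _ : ℕ => H) 2) (a : H →L[ℂ] H) :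
    Summable fun k => inner ℂ (y k) (a (x k)) := by
  have hx : Summable fun k => ‖x k‖ ^ 2 := by
    simpa using (lp.memℓp x).summable (by norm_num)
  have hy : Summable fun k => ‖y k‖ ^ 2 := by
    simpa using (lp.memℓp y).summable (by norm_num)
  refine Summable.of_norm_bounded ((hy.add hx).mul_left ‖a‖) fun k => ?_
  have h1 := norm_inner_le_norm (𝕜 := ℂ) (y k) (a (x k))
  have h2 := mul_le_mul_of_nonneg_left (a.le_opNorm (x k)) (norm_nonneg (y k))
  have h3 : ‖y k‖ * ‖x k‖ ≤ ‖y k‖ ^ 2 + ‖x k‖ ^ 2 := by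
    nlinarith [sq_nonneg (‖y k‖ - ‖x k‖), sq_nonneg ‖y k‖, sq_nonneg ‖x k‖]
  nlinarith [mul_le_mul_of_nonneg_left h3 (norm_nonneg a)]

variable (H) in
/-- The topology of pointwise weak* convergence on the linear maps `B(H) → B(H)`: the coarsest
one such that `φ ↦ ω (φ a)` is continuous for each `a` in `B(H)` and `ω` in its predual. -/
@[reducible]
noncomputable def pointwiseWeakStar : TopologicalSpace (Module.End ℂ (H →L[ℂ] H)) :=
  TopologicalSpace.induced
    (fun φ (p : (H →L[ℂ] H) × lp (fun _ : ℕ => H) 2 × lp (fun _ : ℕ => H) 2) =>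
      normalFunctional p.2.1 p.2.2 (φ p.1))
    inferInstance

/-- The set of all completely contractive maps `B(H) → B(H)` that fix `E` pointwise; the semigroup
operation is composition, which is the multiplication of `Module.End`. -/
def fixingMaps (E : Submodule ℂ (H →L[ℂ] H)) : Set (Module.End ℂ (H →L[ℂ] H)) :=
  {φ | (∀ (n : ℕ) (a : Matrix (Fin n) (Fin n) (H →L[ℂ] H)),
      ‖matrixOp (a.map φ)‖ ≤ ‖matrixOp a‖) ∧ ∀ x ∈ E, φ x = x}

end Maps

end InjectiveEnvelope

/-!
The only deep ingredient is the injectivity of `B(H)` (`exists_completelyContractive_extension`).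
A completely contractive map `φ : A → B(H)`, `A ⊆ B(L)`, is encoded by a real linear functional on
formal `2 × 2` matrices `[[a, u], [u*, b]]` over `H`, whose corner `u` is a sum of tensors
`η ⊗ v ⊗ ξ` with `v ∈ A` and whose diagonal entries are finite rank self-adjoint operators: the
functional is `tr a + tr b + 2 Re ∑ ⟨φ(v) ξ, η⟩`. Testing such a matrix with pairs of linear maps
`H → L` gives a notion of positivity that makes sense for corners in `B(L)` and does not depend on
`A`. Complete contractivity says that the functional is nonnegative on positive matrices
(`FormalMatrix.value_nonneg_of_mem_positiveCone`): diagonalising `a` and `b` writes the corner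
as `a^{1/2} w b^{1/2}` with a contractive matrix `w` over `A`. Every corner is dominated by some
diagonal, so M. Riesz' extension theorem extends the functional to corners in `B(L)`, and the
extension, being nonnegative, comes from a completely contractive map on `B(L)`
(`exists_completelyContractive_of_form`).

The semigroup of completely contractive maps fixing `E` is compact because, in terms of the numbers
`Re ⟨φ(a) ξ, η⟩`, it is a closed subset of a product of intervals, and normal functionals are
uniform limits of finite sums of such numbers (`isCompact_fixingMaps`). An idempotent of a minimal
compact left ideal is then a minimal idempotent (`exists_isMinimalIdempotent`).

The range of an idempotent of the semigroup is injective since `B(H)` is (`isInjective_range`), and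
every injective subspace of `B(H)` containing `E` is such a range
(`exists_idempotent_of_isInjective`). If `φ` is a minimal idempotent and `ψ` an idempotent whose
range lies in that of `φ`, then `ψφ` is an idempotent below `φ`, so that `ψφ = φ` and the ranges
agree; conversely an idempotent below a projection onto an injective envelope has the same range
and equals it.
-/

open ComplexConjugate

namespace InjectiveEnvelope

/-! ### Norms of operator matrices and completely contractive maps as forms -/

section Forms

variable {H : Type*} [NormedAddCommGroup H] [InnerProductSpace ℂ H]

/-- A sesquilinear expression bounded by the arithmetic mean of the squared norms is bounded by
the product of the norms: rescale one of the vectors and rotate its phase. -/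
theorem norm_le_of_two_mul_re_le {V W : Type*} [NormedAddCommGroup V] [NormedSpace ℂ V]
    [NormedAddCommGroup W] [NormedSpace ℂ W] {s : V → W → ℂ}
    (hs : ∀ (c : ℂ) y x, s (c • y) x = conj c * s y x)
    (hs' : ∀ (c : ℂ) y x, s y (c • x) = c * s y x) {C : ℝ}
    (h : ∀ y x, 2 * (s y x).re ≤ C * (‖y‖ ^ 2 + ‖x‖ ^ 2)) (y : V) (x : W) :
    ‖s y x‖ ≤ C * (‖y‖ * ‖x‖) := by
  rcases eq_or_ne x 0 with rfl | hx
  · have := hs' 0 y 0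
    simp at this
    simp [this]
  rcases eq_or_ne y 0 with rfl | hy
  · have := hs 0 0 x
    simp at this
    simp [this]
  rcases eq_or_ne (s y x) 0 with h0 | h0
  · have h1 := h y x
    have h2 : 0 < ‖y‖ ^ 2 + ‖x‖ ^ 2 := by positivity
    have h3 : 0 ≤ C := by
      rw [h0] at h1
      simp only [Complex.zero_re, mul_zero] at h1
      exact nonneg_of_mul_nonneg_left h1 h2
    rw [h0, norm_zero]
    positivity
  have hx' : 0 < ‖x‖ := norm_pos_iff.2 hx
  have hy' : 0 < ‖y‖ := norm_pos_iff.2 hy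
  have hn : 0 < ‖s y x‖ := norm_pos_iff.2 h0
  -- the phase of `s y x` goes into `x`, and both vectors are scaled to norm `‖x‖‖y‖`
  have h1 := h ((‖x‖ : ℂ) • y) (((‖y‖ : ℂ) * conj (s y x) / ‖s y x‖) • x)
  have e1 : s ((‖x‖ : ℂ) • y) (((‖y‖ : ℂ) * conj (s y x) / ‖s y x‖) • x)
      = ((‖x‖ * ‖y‖ * ‖s y x‖ : ℝ) : ℂ) := by
    rw [hs, hs', Complex.conj_ofReal]
    have hn' : ((‖s y x‖ : ℝ) : ℂ) ≠ 0 := by exact_mod_cast hn.ne'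
    have : conj (s y x) * s y x = (‖s y x‖ : ℂ) ^ 2 := Complex.conj_mul' _
    push_cast
    field_simp
    linear_combination (‖x‖ * ‖y‖ : ℂ) * this
  rw [e1, Complex.ofReal_re, norm_smul, norm_smul, norm_div, norm_mul] at h1
  simp only [Complex.norm_real, norm_norm, RCLike.norm_conj, mul_div_assoc, div_self hn.ne',
    mul_one] at h1
  have h2 : 0 < ‖x‖ * ‖y‖ := by positivity
  nlinarith

theorem inner_matrixOp {n : ℕ} (a : Matrix (Fin n) (Fin n) (H →L[ℂ] H))
    (y x : PiLp 2 (fun _ : Fin n => H)) :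
    inner ℂ y (matrixOp a x) = ∑ i, ∑ j, inner ℂ (y i) (a i j (x j)) := by
  simp [PiLp.inner_apply, matrixOp_apply, inner_sum]

/-- The norm of `M_n(B(H)) = B(Hⁿ)` in terms of the real parts of the matrix coefficients. -/
theorem norm_matrixOp_le_iff {n : ℕ} {a : Matrix (Fin n) (Fin n) (H →L[ℂ] H)} {C : ℝ}
    (hC : 0 ≤ C) : ‖matrixOp a‖ ≤ C ↔ ∀ y x : Fin n → H,
      2 * ∑ i, ∑ j, (inner ℂ (y i) (a i j (x j))).re
        ≤ C * (∑ i, ‖y i‖ ^ 2 + ∑ j, ‖x j‖ ^ 2) := by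
  have key : ∀ y x : PiLp 2 (fun _ : Fin n => H),
      ∑ i, ∑ j, (inner ℂ (y i) (a i j (x j))).re = (inner ℂ y (matrixOp a x)).re := by
    intro y x
    simp [inner_matrixOp]
  constructor
  · intro h y x
    have e := key (WithLp.toLp 2 y) (WithLp.toLp 2 x)
    have h1 : (inner ℂ (WithLp.toLp 2 y) (matrixOp a (WithLp.toLp 2 x))).re
        ≤ ‖WithLp.toLp 2 y‖ * (C * ‖WithLp.toLp 2 x‖) :=
      (Complex.re_le_norm _).trans ((norm_inner_le_norm _ _).trans
        (mul_le_mul_of_nonneg_left ((matrixOp a).le_of_opNorm_le h _) (norm_nonneg _)))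
    have hy : ∑ i, ‖y i‖ ^ 2 = ‖WithLp.toLp 2 y‖ ^ 2 := by simp [PiLp.norm_sq_eq_of_L2]
    have hx : ∑ i, ‖x i‖ ^ 2 = ‖WithLp.toLp 2 x‖ ^ 2 := by simp [PiLp.norm_sq_eq_of_L2]
    simp only at e
    rw [e, hy, hx]
    nlinarith [mul_nonneg hC (sq_nonneg (‖WithLp.toLp 2 y‖ - ‖WithLp.toLp 2 x‖))]
  · intro h
    refine (matrixOp a).opNorm_le_bound hC fun x => ?_
    have h1 := norm_le_of_two_mul_re_le
      (s := fun y x : PiLp 2 (fun _ : Fin n => H) => inner ℂ y (matrixOp a x)) (C := C)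
      (fun c y x => inner_smul_left _ _ _)
      (fun c y x => by rw [map_smul, inner_smul_right])
      (fun y x => by
        rw [PiLp.norm_sq_eq_of_L2, PiLp.norm_sq_eq_of_L2, ← key]
        exact h y x) (matrixOp a x) x
    rcases eq_or_ne (matrixOp a x) 0 with h0 | h0
    · rw [h0, norm_zero]
      positivity
    · have h2 : 0 < ‖matrixOp a x‖ := norm_pos_iff.2 h0
      simp only [inner_self_eq_norm_sq_to_K, norm_pow, RCLike.norm_ofReal, abs_norm] at h1
      nlinarith

theorem ext_of_re_inner {S T : H →L[ℂ] H}
    (h : ∀ η ξ, (inner ℂ η (S ξ)).re = (inner ℂ η (T ξ)).re) : S = T := by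
  ext ξ
  have h1 := h (S ξ - T ξ) ξ
  have h2 : (inner ℂ (S ξ - T ξ) (S ξ - T ξ)).re = 0 := by
    rw [inner_sub_right, Complex.sub_re, h1, sub_self]
  rw [← sub_eq_zero]
  rw [← norm_eq_zero, ← sq_eq_zero_iff, ← h2]
  exact (inner_self_eq_norm_sq (𝕜 := ℂ) _).symm

/-- A completely contractive map `B(L) → B(H)` is the same thing as a family of real parts of
matrix coefficients `r a η ξ = Re ⟨φ(a) ξ, η⟩` with the obvious linearity properties and the norm
bounds at every matrix level. -/
theorem exists_completelyContractive_of_form {L : Type*} [NormedAddCommGroup L]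
    [InnerProductSpace ℂ L] [CompleteSpace H] (r : (L →L[ℂ] L) → H → H → ℝ)
    (add₁ : ∀ a b η ξ, r (a + b) η ξ = r a η ξ + r b η ξ)
    (smul₁ : ∀ (t : ℝ) a η ξ, r ((t : ℂ) • a) η ξ = t * r a η ξ)
    (add₂ : ∀ a η η' ξ, r a (η + η') ξ = r a η ξ + r a η' ξ)
    (smul₂ : ∀ (c : ℂ) a η ξ, r a (c • η) ξ = r (conj c • a) η ξ)
    (add₃ : ∀ a η ξ ξ', r a η (ξ + ξ') = r a η ξ + r a η ξ')
    (smul₃ : ∀ (c : ℂ) a η ξ, r a η (c • ξ) = r (c • a) η ξ)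
    (bound : ∀ (n : ℕ) (a : Matrix (Fin n) (Fin n) (L →L[ℂ] L)) (y x : Fin n → H),
      2 * ∑ i, ∑ j, r (a i j) (y i) (x j)
        ≤ ‖matrixOp a‖ * (∑ i, ‖y i‖ ^ 2 + ∑ j, ‖x j‖ ^ 2)) :
    ∃ φ : (L →L[ℂ] L) →ₗ[ℂ] (H →L[ℂ] H),
      (∀ a η ξ, (inner ℂ η (φ a ξ)).re = r a η ξ) ∧
      ∀ (n : ℕ) (a : Matrix (Fin n) (Fin n) (L →L[ℂ] L)), ‖matrixOp (a.map φ)‖ ≤ ‖matrixOp a‖ := by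
  -- the complex form with real part `r`
  let g : (L →L[ℂ] L) → H → H → ℂ := fun a η ξ => r a η ξ - Complex.I * r (Complex.I • a) η ξ
  have g_re : ∀ a η ξ, (g a η ξ).re = r a η ξ := by intro a η ξ; simp [g]
  have g_add₁ : ∀ a b η ξ, g (a + b) η ξ = g a η ξ + g b η ξ := by
    intro a b η ξ
    simp only [g, smul_add, add₁]
    push_cast
    ring
  have g_smul₁ : ∀ (c : ℂ) a η ξ, g (c • a) η ξ = c * g a η ξ := by
    intro c a η ξ
    have h1 : ∀ b : L →L[ℂ] L, r (c • b) η ξ = c.re * r b η ξ + c.im * r (Complex.I • b) η ξ := by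
      intro b
      rw [← smul₁, ← smul₁, ← add₁, smul_smul, ← add_smul, Complex.re_add_im]
    have h2 : r (Complex.I • c • a) η ξ = c.re * r (Complex.I • a) η ξ - c.im * r a η ξ := by
      rw [smul_comm, h1, smul_smul, Complex.I_mul_I]
      have := smul₁ (-1) a η ξ
      simp only [Complex.ofReal_neg, Complex.ofReal_one] at this
      rw [this]
      ring
    simp only [g]
    rw [h2, h1]
    apply Complex.ext
    · simp
    · simp
      ring
  have g_add₂ : ∀ a η η' ξ, g a (η + η') ξ = g a η ξ + g a η' ξ := by
    intro a η η' ξ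
    simp only [g, add₂]
    push_cast
    ring
  have g_smul₂ : ∀ (c : ℂ) a η ξ, g a (c • η) ξ = conj c * g a η ξ := by
    intro c a η ξ
    rw [← g_smul₁]
    simp only [g, smul₂, smul_comm Complex.I (conj c) a]
  have g_add₃ : ∀ a η ξ ξ', g a η (ξ + ξ') = g a η ξ + g a η ξ' := by
    intro a η ξ ξ'
    simp only [g, add₃]
    push_cast
    ring
  have g_smul₃ : ∀ (c : ℂ) a η ξ, g a η (c • ξ) = c * g a η ξ := by
    intro c a η ξ
    rw [← g_smul₁]
    simp only [g, smul₃, smul_comm Complex.I c a]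
  have g_bound : ∀ a η ξ, ‖g a η ξ‖ ≤ ‖matrixOp (fun _ _ : Fin 1 => a)‖ * (‖η‖ * ‖ξ‖) := by
    intro a
    refine norm_le_of_two_mul_re_le (g_smul₂ · a) (g_smul₃ · a) fun y x => ?_
    have := bound 1 (fun _ _ => a) (fun _ => y) (fun _ => x)
    simpa [g_re] using this
  -- for each `a`, the bounded operator with matrix coefficients `g a`
  have hop : ∀ a, ∃ T : H →L[ℂ] H, ∀ η ξ, inner ℂ η (T ξ) = g a η ξ := by
    intro a
    let B : H →L⋆[ℂ] H →L[ℂ] ℂ := LinearMap.mkContinuous₂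
      (LinearMap.mk₂'ₛₗ (starRingEnd ℂ) (RingHom.id ℂ) (g a) (g_add₂ a) (fun c => g_smul₂ c a)
        (g_add₃ a) (fun c => g_smul₃ c a)) ‖matrixOp (fun _ _ : Fin 1 => a)‖ (fun η ξ => by
          rw [mul_assoc]; exact g_bound a η ξ)
    refine ⟨ContinuousLinearMap.adjoint (InnerProductSpace.continuousLinearMapOfBilin B),
      fun η ξ => ?_⟩
    rw [ContinuousLinearMap.adjoint_inner_right,
      InnerProductSpace.continuousLinearMapOfBilin_apply]
    rfl
  choose T hT using hop
  let φ : (L →L[ℂ] L) →ₗ[ℂ] (H →L[ℂ] H) :=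
    { toFun := T
      map_add' := fun a b => ext_of_re_inner fun η ξ => by
        rw [hT, g_add₁, add_apply, inner_add_right, hT, hT]
      map_smul' := fun c a => ext_of_re_inner fun η ξ => by
        rw [hT, g_smul₁, RingHom.id_apply, smul_apply, inner_smul_right, hT] }
  have hφ : ∀ a η ξ, (inner ℂ η (φ a ξ)).re = r a η ξ := fun a η ξ => by
    change (inner ℂ η (T a ξ)).re = _
    rw [hT, g_re]
  refine ⟨φ, hφ, fun n a => (norm_matrixOp_le_iff (norm_nonneg (matrixOp a))).2 fun y x => ?_⟩
  simpa only [Matrix.map_apply, hφ] using bound n a y x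

end Forms

/-! ### Injectivity of `B(H)` -/

section Extension

/-- A real quadratic expression `∑ aᵢ ‖y(wᵢ)‖²`, as a function of the linear map `y`, can be
diagonalised by an orthonormal basis: take the eigenvectors of `∑ aᵢ wᵢ ⊗ wᵢ*`. -/
theorem exists_orthonormalBasis_sum_norm_sq {V ι : Type*} [NormedAddCommGroup V]
    [InnerProductSpace ℂ V] [FiniteDimensional ℂ V] (s : Finset ι) (a : ι → ℝ) (w : ι → V) :
    ∃ (b : OrthonormalBasis (Fin (Module.finrank ℂ V)) ℂ V)
      (c : Fin (Module.finrank ℂ V) → ℝ),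
      ∀ {N : Type u} [NormedAddCommGroup N] [InnerProductSpace ℂ N] (y : V →ₗ[ℂ] N),
        ∑ i ∈ s, a i * ‖y (w i)‖ ^ 2 = ∑ k, c k * ‖y (b k)‖ ^ 2 := by
  let T : V →ₗ[ℂ] V := ∑ i ∈ s, (a i : ℂ) • (InnerProductSpace.rankOne ℂ (w i) (w i)).toLinearMap
  have hTinner : ∀ x z, inner ℂ z (T x) = ∑ i ∈ s, a i * (inner ℂ (w i) x * inner ℂ z (w i)) := by
    intro x z
    simp [T, LinearMap.sum_apply]
  have hT : T.IsSymmetric := by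
    intro x z
    rw [← inner_conj_symm, hTinner, hTinner, map_sum]
    refine Finset.sum_congr rfl fun i _ => ?_
    simp only [map_mul, Complex.conj_ofReal, inner_conj_symm]
    ring
  refine ⟨hT.eigenvectorBasis rfl, hT.eigenvalues rfl, fun {N} _ _ y => ?_⟩
  set b := hT.eigenvectorBasis rfl
  have hb : ∀ k l, ∑ i ∈ s, a i * (inner ℂ (w i) (b k) * inner ℂ (b l) (w i))
      = if l = k then (hT.eigenvalues rfl k : ℂ) else 0 := by
    intro k l
    rw [← hTinner, hT.apply_eigenvectorBasis, inner_smul_right,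
      orthonormal_iff_ite.1 b.orthonormal]
    simp
  have hexp : ∀ i, ((‖y (w i)‖ ^ 2 : ℝ) : ℂ)
      = ∑ k, ∑ l, inner ℂ (w i) (b k) * inner ℂ (b l) (w i) * inner ℂ (y (b k)) (y (b l)) := by
    intro i
    have h1 : y (w i) = ∑ k, inner ℂ (b k) (w i) • y (b k) := by
      conv_lhs => rw [← b.sum_repr' (w i)]
      simp
    have h2 : ((‖y (w i)‖ ^ 2 : ℝ) : ℂ) = inner ℂ (y (w i)) (y (w i)) := by
      rw [inner_self_eq_norm_sq_to_K]; push_cast; rfl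
    rw [h2, h1, sum_inner]
    refine Finset.sum_congr rfl fun k _ => ?_
    rw [inner_sum]
    refine Finset.sum_congr rfl fun l _ => ?_
    rw [inner_smul_left, inner_smul_right, inner_conj_symm]
    ring
  have : ((∑ i ∈ s, a i * ‖y (w i)‖ ^ 2 : ℝ) : ℂ)
      = ((∑ k, hT.eigenvalues rfl k * ‖y (b k)‖ ^ 2 : ℝ) : ℂ) := by
    rw [Complex.ofReal_sum, Complex.ofReal_sum]
    simp only [Complex.ofReal_mul, hexp, Finset.mul_sum]
    rw [Finset.sum_comm]
    refine Finset.sum_congr rfl fun k _ => ?_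
    rw [Finset.sum_comm]
    have : ∀ l, ∑ i ∈ s, (a i : ℂ) * (inner ℂ (w i) (b k) * inner ℂ (b l) (w i)
        * inner ℂ (y (b k)) (y (b l)))
        = (if l = k then (hT.eigenvalues rfl k : ℂ) else 0) * inner ℂ (y (b k)) (y (b l)) := by
      intro l
      rw [← hb, Finset.sum_mul]
      exact Finset.sum_congr rfl fun i _ => by ring
    simp only [this, ite_mul, zero_mul, Finset.sum_ite_eq', Finset.mem_univ,
      if_true]
    rw [inner_self_eq_norm_sq_to_K]
    push_cast
    rfl
  exact_mod_cast this

variable {L : Type u} [NormedAddCommGroup L] [InnerProductSpace ℂ L]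
  {H : Type u} [NormedAddCommGroup H] [InnerProductSpace ℂ H]

variable (L H) in
/-- Formal `2 × 2` matrices `[[a, u], [u*, b]]` over `H`: the corner `u` is a finite formal sum of
tensors `η ⊗ v ⊗ ξ` with `v ∈ B(L)` and `η, ξ ∈ H`, and the diagonal entries `a`, `b` are finite
formal real combinations of the rank one operators `η ⊗ η*`. -/
abbrev FormalMatrix : Type u := ((H × H) →₀ (L →L[ℂ] L)) × (H →₀ ℝ) × (H →₀ ℝ)

/-- The value of a formal `2 × 2` matrix, the corner being mapped by `T : B(L) → B(N)`, at the pair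
of linear maps `y, x : H → N`. -/
noncomputable def FormalMatrix.value {N : Type u} [NormedAddCommGroup N] [InnerProductSpace ℂ N]
    (T : (L →L[ℂ] L) →ₗ[ℂ] (N →L[ℂ] N)) (y x : H →ₗ[ℂ] N) : FormalMatrix L H →ₗ[ℝ] ℝ :=
  (2 : ℝ) • (Finsupp.lsum ℝ fun p : H × H =>
    ({ toFun := fun v => (inner ℂ (y p.1) (T v (x p.2))).re
       map_add' := fun v w => by simp
       map_smul' := fun t v => by
        have : T (t • v) = (t : ℂ) • T v := by rw [← map_smul]; rfl
        simp [this] } : (L →L[ℂ] L) →ₗ[ℝ] ℝ)) ∘ₗ LinearMap.fst ℝ _ _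
  + (Finsupp.linearCombination ℝ fun η => ‖y η‖ ^ 2) ∘ₗ LinearMap.fst ℝ _ _ ∘ₗ LinearMap.snd ℝ _ _
  + (Finsupp.linearCombination ℝ fun ξ => ‖x ξ‖ ^ 2) ∘ₗ LinearMap.snd ℝ _ _ ∘ₗ LinearMap.snd ℝ _ _

namespace FormalMatrix

variable {N : Type u} [NormedAddCommGroup N] [InnerProductSpace ℂ N]

theorem value_apply (T : (L →L[ℂ] L) →ₗ[ℂ] (N →L[ℂ] N)) (y x : H →ₗ[ℂ] N)
    (e : FormalMatrix L H) : value T y x e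
      = 2 * ∑ p ∈ e.1.support, (inner ℂ (y p.1) (T (e.1 p) (x p.2))).re
        + ∑ η ∈ e.2.1.support, e.2.1 η * ‖y η‖ ^ 2 + ∑ ξ ∈ e.2.2.support, e.2.2 ξ * ‖x ξ‖ ^ 2 := by
  simp [value, Finsupp.linearCombination_apply, Finsupp.sum]

@[simp]
theorem value_single_corner (T : (L →L[ℂ] L) →ₗ[ℂ] (N →L[ℂ] N)) (y x : H →ₗ[ℂ] N) (η ξ : H)
    (v : L →L[ℂ] L) :
    value T y x (Finsupp.single (η, ξ) v, 0) = 2 * (inner ℂ (y η) (T v (x ξ))).re := by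
  simp [value]

@[simp]
theorem value_single_left (T : (L →L[ℂ] L) →ₗ[ℂ] (N →L[ℂ] N)) (y x : H →ₗ[ℂ] N) (η : H)
    (t : ℝ) : value T y x (0, Finsupp.single η t, 0) = t * ‖y η‖ ^ 2 := by
  simp [value]

@[simp]
theorem value_single_right (T : (L →L[ℂ] L) →ₗ[ℂ] (N →L[ℂ] N)) (y x : H →ₗ[ℂ] N) (ξ : H)
    (t : ℝ) : value T y x (0, 0, Finsupp.single ξ t) = t * ‖x ξ‖ ^ 2 := by
  simp [value]

/-- In suitable orthonormal systems `f` and `g`, the diagonal entries `a` and `b` of a formal `2 × 2`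
matrix become diagonal, while the corner keeps its coefficients in `A`. -/
theorem exists_orthonormal_value (A : Submodule ℂ (L →L[ℂ] L)) (e : FormalMatrix L H)
    (he : ∀ p, e.1 p ∈ A) :
    ∃ (m : ℕ) (f g : Fin m → H) (c d : Fin m → ℝ) (v : Fin m → Fin m → (L →L[ℂ] L)),
      Orthonormal ℂ f ∧ Orthonormal ℂ g ∧ (∀ k l, v k l ∈ A) ∧
      ∀ {N : Type u} [NormedAddCommGroup N] [InnerProductSpace ℂ N]
        (T : (L →L[ℂ] L) →ₗ[ℂ] (N →L[ℂ] N)) (y x : H →ₗ[ℂ] N), value T y x e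
          = 2 * ∑ k, ∑ l, (inner ℂ (y (f k)) (T (v k l) (x (g l)))).re
            + ∑ k, c k * ‖y (f k)‖ ^ 2 + ∑ l, d l * ‖x (g l)‖ ^ 2 := by
  classical
  let s : Finset H := e.1.support.image Prod.fst ∪ e.1.support.image Prod.snd
    ∪ e.2.1.support ∪ e.2.2.support
  let V : Submodule ℂ H := Submodule.span ℂ (s : Set H)
  have : FiniteDimensional ℂ V := FiniteDimensional.span_finset ℂ s
  let P : H → V := fun η => V.orthogonalProjectionOnto η
  have hP : ∀ η ∈ s, (P η : H) = η := fun η hη =>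
    Submodule.starProjection_eq_self_iff.2 (Submodule.subset_span hη)
  have h1 : ∀ p ∈ e.1.support, p.1 ∈ s := fun p hp => by
    have := Finset.mem_image_of_mem Prod.fst hp
    simp only [s, Finset.mem_union]; tauto
  have h2 : ∀ p ∈ e.1.support, p.2 ∈ s := fun p hp => by
    have := Finset.mem_image_of_mem Prod.snd hp
    simp only [s, Finset.mem_union]; tauto
  have h3 : ∀ η ∈ e.2.1.support, η ∈ s := fun η hη => by
    simp only [s, Finset.mem_union]; tauto
  have h4 : ∀ η ∈ e.2.2.support, η ∈ s := fun η hη => by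
    simp only [s, Finset.mem_union]; tauto
  obtain ⟨f, c, hc⟩ := exists_orthonormalBasis_sum_norm_sq.{u} e.2.1.support e.2.1 P
  obtain ⟨g, d, hd⟩ := exists_orthonormalBasis_sum_norm_sq.{u} e.2.2.support e.2.2 P
  refine ⟨_, fun k => f k, fun l => g l, c, d,
    fun k l => ∑ p ∈ e.1.support, (conj (inner ℂ (f k) (P p.1)) * inner ℂ (g l) (P p.2)) • e.1 p,
    f.orthonormal.comp_linearIsometry V.subtypeₗᵢ, g.orthonormal.comp_linearIsometry V.subtypeₗᵢ,
    fun k l => A.sum_mem fun p _ => A.smul_mem _ (he p), fun {N} _ _ T y x => ?_⟩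
  have hexp : ∀ (b : OrthonormalBasis (Fin (Module.finrank ℂ V)) ℂ V) (z : H →ₗ[ℂ] N),
      ∀ η ∈ s, z η = ∑ k, inner ℂ (b k) (P η) • z (b k) := by
    intro b z η hη
    conv_lhs => rw [← hP η hη, ← b.sum_repr' (P η)]
    simp
  rw [value_apply]
  congr 1
  · congr 1
    · congr 1
      have : ∀ p ∈ e.1.support, (inner ℂ (y p.1) (T (e.1 p) (x p.2))).re
          = ∑ k, ∑ l, (inner ℂ (y (f k)) (((conj (inner ℂ (f k) (P p.1)) * inner ℂ (g l) (P p.2)) •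
            T (e.1 p)) (x (g l)))).re := by
        intro p hp
        rw [hexp f y p.1 (h1 p hp), hexp g x p.2 (h2 p hp), map_sum, sum_inner, Complex.re_sum]
        refine Finset.sum_congr rfl fun k _ => ?_
        rw [inner_sum, Complex.re_sum]
        refine Finset.sum_congr rfl fun l _ => ?_
        rw [map_smul, inner_smul_left, inner_smul_right, smul_apply, inner_smul_right, mul_assoc]
      rw [Finset.sum_congr rfl this, Finset.sum_comm]
      refine Finset.sum_congr rfl fun k _ => ?_
      rw [Finset.sum_comm]
      refine Finset.sum_congr rfl fun l _ => ?_
      simp only [map_sum, map_smul, sum_apply, inner_sum, Complex.re_sum]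
    · refine Eq.trans ?_ (hc (y ∘ₗ V.subtype))
      exact Finset.sum_congr rfl fun η hη => by simp [hP η (h3 η hη)]
  · refine Eq.trans ?_ (hd (x ∘ₗ V.subtype))
    exact Finset.sum_congr rfl fun η hη => by simp [hP η (h4 η hη)]

variable (L H) in
/-- The formal `2 × 2` matrices with corner in `B(L)` that are positive, that is, nonnegative on
all pairs of linear maps `H → L`. Testing only with linear maps identifies formal sums that
represent the same tensor. -/
def positiveCone : PointedCone ℝ (FormalMatrix L H) where
  carrier := {e | ∀ y x : H →ₗ[ℂ] L, 0 ≤ value LinearMap.id y x e}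
  add_mem' := fun h h' y x => by
    rw [map_add]
    exact add_nonneg (h y x) (h' y x)
  zero_mem' := fun y x => by simp
  smul_mem' := fun t e h y x => by
    have : value LinearMap.id y x (t • e) = t * value LinearMap.id y x e := by
      rw [← smul_eq_mul, ← map_smul]; rfl
    rw [this]
    exact mul_nonneg t.2 (h y x)

/-- A complete contraction on `A` maps positive formal matrices with corner in `A` to positive
ones. After diagonalisation, and up to an arbitrarily small perturbation, the corner is
`vₖₗ = √cₖ wₖₗ √dₗ` with a contractive matrix `w` over `A`, to which the assumption applies. -/
theorem value_nonneg_of_mem_positiveCone [Nontrivial L] {A : Submodule ℂ (L →L[ℂ] L)}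
    {T : (L →L[ℂ] L) →ₗ[ℂ] (H →L[ℂ] H)}
    (hT : ∀ (n : ℕ) (a : Matrix (Fin n) (Fin n) (L →L[ℂ] L)), (∀ i j, a i j ∈ A) →
      ‖matrixOp (a.map T)‖ ≤ ‖matrixOp a‖)
    {e : FormalMatrix L H} (he : ∀ p, e.1 p ∈ A) (hpos : e ∈ positiveCone L H) :
    0 ≤ value T LinearMap.id LinearMap.id e := by
  obtain ⟨m, f, g, c, d, v, hf, hg, hv, hval⟩ := exists_orthonormal_value A e he
  have hlift : ∀ {f : Fin m → H}, Orthonormal ℂ f → ∀ Y : Fin m → L,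
      ∃ y : H →ₗ[ℂ] L, ∀ k, y (f k) = Y k := by
    intro f hf Y
    refine ⟨∑ k, (innerSL ℂ (f k)).toLinearMap.smulRight (Y k), fun l => ?_⟩
    simp [LinearMap.sum_apply, orthonormal_iff_ite.1 hf]
  have hpos' : ∀ Y X : Fin m → L, 0 ≤ 2 * ∑ k, ∑ l, (inner ℂ (Y k) (v k l (X l))).re
      + ∑ k, c k * ‖Y k‖ ^ 2 + ∑ l, d l * ‖X l‖ ^ 2 := by
    intro Y X
    obtain ⟨y, hy⟩ := hlift hf Y
    obtain ⟨x, hx⟩ := hlift hg X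
    have := hpos y x
    simpa [hval, hy, hx] using this
  obtain ⟨z, hz⟩ := exists_norm_eq L zero_le_one
  have hc : ∀ k, 0 ≤ c k := by
    intro k
    have := hpos' (Pi.single k z) 0
    rw [Finset.sum_eq_single (f := fun k' => c k' * _) k] at this
    · simpa [hz] using this
    · intro k' _ hk'
      simp [hk']
    · simp
  have hd : ∀ k, 0 ≤ d k := by
    intro k
    have := hpos' 0 (Pi.single k z)
    rw [Finset.sum_eq_single (f := fun k' => d k' * _) k] at this
    · simpa [hz] using this
    · intro k' _ hk'
      simp [hk']
    · simp
  rw [hval]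
  simp only [LinearMap.id_coe, id_eq, hf.1, hg.1, one_pow, mul_one]
  -- perturb the diagonal entries so that they are strictly positive
  refine le_of_forall_pos_le_add fun ε' hε' => ?_
  obtain ⟨ε, hε, hεε'⟩ : ∃ ε > 0, 2 * m * ε ≤ ε' := by
    refine ⟨ε' / (2 * m + 1), by positivity, ?_⟩
    rw [mul_div_assoc', div_le_iff₀ (by positivity)]
    nlinarith
  let α : Fin m → ℝ := fun k => √(c k + ε)
  let β : Fin m → ℝ := fun l => √(d l + ε)
  have hα : ∀ k, 0 < α k := fun k => Real.sqrt_pos.2 (by linarith [hc k])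
  have hβ : ∀ k, 0 < β k := fun k => Real.sqrt_pos.2 (by linarith [hd k])
  have hα2 : ∀ k, α k ^ 2 = c k + ε := fun k => Real.sq_sqrt (by linarith [hc k])
  have hβ2 : ∀ k, β k ^ 2 = d k + ε := fun k => Real.sq_sqrt (by linarith [hd k])
  let w : Matrix (Fin m) (Fin m) (L →L[ℂ] L) :=
    fun k l => (((α k)⁻¹ * (β l)⁻¹ : ℝ) : ℂ) • v k l
  have hw : ‖matrixOp w‖ ≤ 1 := by
    refine (norm_matrixOp_le_iff zero_le_one).2 fun Y X => ?_
    have h1 := hpos' (fun k => (-(α k : ℂ)⁻¹) • Y k) (fun l => (β l : ℂ)⁻¹ • X l)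
    have h2 : ∀ k l, (inner ℂ ((-(α k : ℂ)⁻¹) • Y k) (v k l ((β l : ℂ)⁻¹ • X l))).re
        = - (inner ℂ (Y k) (w k l (X l))).re := by
      intro k l
      rw [map_smul, inner_smul_left, inner_smul_right]
      simp only [w, smul_apply, inner_smul_right]
      rw [← Complex.neg_re]
      congr 1
      push_cast
      simp only [map_neg, map_inv₀, Complex.conj_ofReal]
      ring
    have h3 : ∀ k, c k * ‖(-(α k : ℂ)⁻¹) • Y k‖ ^ 2 ≤ ‖Y k‖ ^ 2 := by
      intro k
      rw [norm_smul, norm_neg, norm_inv, Complex.norm_real, Real.norm_of_nonneg (hα k).le, mul_pow,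
        inv_pow, hα2, ← mul_assoc]
      refine mul_le_of_le_one_left (by positivity) ?_
      rw [← div_eq_mul_inv, div_le_one (by linarith [hc k])]
      linarith
    have h4 : ∀ k, d k * ‖(β k : ℂ)⁻¹ • X k‖ ^ 2 ≤ ‖X k‖ ^ 2 := by
      intro k
      rw [norm_smul, norm_inv, Complex.norm_real, Real.norm_of_nonneg (hβ k).le, mul_pow,
        inv_pow, hβ2, ← mul_assoc]
      refine mul_le_of_le_one_left (by positivity) ?_
      rw [← div_eq_mul_inv, div_le_one (by linarith [hd k])]
      linarith
    simp only [h2, Finset.sum_neg_distrib] at h1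
    have h5 := Finset.sum_le_sum fun k (_ : k ∈ Finset.univ) => h3 k
    have h6 := Finset.sum_le_sum fun k (_ : k ∈ Finset.univ) => h4 k
    linarith
  have h1 := (norm_matrixOp_le_iff zero_le_one).1
    ((hT m w fun k l => A.smul_mem _ (hv k l)).trans hw)
    (fun k => (-(α k) : ℂ) • f k) (fun l => (β l : ℂ) • g l)
  have h2 : ∀ k l, (inner ℂ ((-(α k) : ℂ) • f k) ((w.map T) k l ((β l : ℂ) • g l))).re
      = - (inner ℂ (f k) (T (v k l) (g l))).re := by
    intro k l
    have hα' : (α k : ℂ) ≠ 0 := by exact_mod_cast (hα k).ne'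
    have hβ' : (β l : ℂ) ≠ 0 := by exact_mod_cast (hβ l).ne'
    rw [Matrix.map_apply, map_smul, inner_smul_left, inner_smul_right]
    simp only [w, map_smul, smul_apply, inner_smul_right]
    rw [← Complex.neg_re]
    congr 1
    push_cast
    simp only [map_neg, Complex.conj_ofReal]
    field_simp
  have h3 : ∀ k, ‖(-(α k) : ℂ) • f k‖ ^ 2 = c k + ε := by
    intro k
    rw [norm_smul, norm_neg, Complex.norm_real, Real.norm_of_nonneg (hα k).le, hf.1, mul_one, hα2]
  have h4 : ∀ k, ‖(β k : ℂ) • g k‖ ^ 2 = d k + ε := by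
    intro k
    rw [norm_smul, Complex.norm_real, Real.norm_of_nonneg (hβ k).le, hg.1, mul_one, hβ2]
  simp only [h2, h3, h4, Finset.sum_neg_distrib, Finset.sum_add_distrib, Finset.sum_const,
    Finset.card_univ, Fintype.card_fin, nsmul_eq_mul] at h1
  linarith

end FormalMatrix

open FormalMatrix

/-- The Arveson–Wittstock extension theorem: `B(H)` is injective. -/
theorem exists_completelyContractive_extension [CompleteSpace H] (A : Submodule ℂ (L →L[ℂ] L))
    (φ : A →ₗ[ℂ] (H →L[ℂ] H))
    (hφ : ∀ (n : ℕ) (a : Matrix (Fin n) (Fin n) A),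
      ‖matrixOp (a.map φ)‖ ≤ ‖matrixOp (a.map fun x => (x : L →L[ℂ] L))‖) :
    ∃ ψ : (L →L[ℂ] L) →ₗ[ℂ] (H →L[ℂ] H),
      (∀ (n : ℕ) (a : Matrix (Fin n) (Fin n) (L →L[ℂ] L)),
        ‖matrixOp (a.map ψ)‖ ≤ ‖matrixOp a‖) ∧ ∀ x : A, ψ x = φ x := by
  -- for `L = 0` every formal matrix is positive, and the argument below breaks down
  rcases subsingleton_or_nontrivial L with hL | hL
  · refine ⟨0, fun n a => ?_, fun x => ?_⟩
    · have : a.map (0 : (L →L[ℂ] L) →ₗ[ℂ] (H →L[ℂ] H)) = 0 := by ext; simp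
      rw [this, (norm_matrixOp_le_iff le_rfl).2 (by simp) |>.antisymm (norm_nonneg _)]
      exact norm_nonneg _
    · rw [Subsingleton.elim x 0]
      simp
  -- a merely linear extension, used only on `A`
  obtain ⟨T, hTφ⟩ := φ.exists_extend
  have hTφ' : ∀ x : A, T x = φ x := fun x => LinearMap.congr_fun hTφ x
  have hT : ∀ (n : ℕ) (a : Matrix (Fin n) (Fin n) (L →L[ℂ] L)), (∀ i j, a i j ∈ A) →
      ‖matrixOp (a.map T)‖ ≤ ‖matrixOp a‖ := by
    intro n a ha
    have h1 : a.map T = Matrix.map (fun i j => (⟨a i j, ha i j⟩ : A)) φ := by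
      ext1 i j
      exact hTφ' ⟨a i j, ha i j⟩
    rw [h1]
    exact hφ n _
  let D : Submodule ℝ (FormalMatrix L H) :=
    { carrier := {e | ∀ p, e.1 p ∈ A}
      add_mem' := fun h h' p => A.add_mem (h p) (h' p)
      zero_mem' := fun p => A.zero_mem
      smul_mem' := fun t e h p => A.smul_mem (t : ℂ) (h p) }
  obtain ⟨G, hGext, hGpos⟩ := riesz_extension (positiveCone L H)
    ⟨D, value T LinearMap.id LinearMap.id ∘ₗ D.subtype⟩
    (fun e he => value_nonneg_of_mem_positiveCone hT e.2 he) (by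
      rintro ⟨q, a, b⟩
      -- the diagonal entries `∑ ‖v‖ η ⊗ η*` and `∑ ‖v‖ ξ ⊗ ξ*` dominate the corner `∑ η ⊗ v ⊗ ξ`
      refine ⟨⟨(0, ∑ p ∈ q.support, Finsupp.single p.1 ‖q p‖ - a,
        ∑ p ∈ q.support, Finsupp.single p.2 ‖q p‖ - b), fun p => A.zero_mem⟩, fun y x => ?_⟩
      have h1 : ((0, ∑ p ∈ q.support, Finsupp.single p.1 ‖q p‖ - a,
          ∑ p ∈ q.support, Finsupp.single p.2 ‖q p‖ - b) + (q, a, b) : FormalMatrix L H)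
          = ∑ p ∈ q.support, ((Finsupp.single p (q p), 0) + (0, Finsupp.single p.1 ‖q p‖, 0)
            + (0, 0, Finsupp.single p.2 ‖q p‖)) := by
        rw [Finset.sum_add_distrib, Finset.sum_add_distrib]
        refine Prod.ext ?_ (Prod.ext ?_ ?_)
        · simp only [Prod.fst_add, Prod.fst_sum, zero_add, add_zero, Finset.sum_const_zero]
          exact (Finsupp.sum_single q).symm
        · simp [Prod.fst_sum, Prod.snd_sum]
        · simp [Prod.snd_sum]
      change 0 ≤ value _ y x ((0, ∑ p ∈ q.support, Finsupp.single p.1 ‖q p‖ - a,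
          ∑ p ∈ q.support, Finsupp.single p.2 ‖q p‖ - b) + (q, a, b))
      rw [h1, map_sum]
      refine Finset.sum_nonneg fun p _ => ?_
      rw [map_add, map_add, value_single_corner, value_single_left, value_single_right]
      have h2 := (abs_le.1 ((Complex.abs_re_le_norm _).trans
        (norm_inner_le_norm (𝕜 := ℂ) (y p.1) (q p (x p.2))))).1
      have h3 := mul_le_mul_of_nonneg_left ((q p).le_opNorm (x p.2)) (norm_nonneg (y p.1))
      rw [LinearMap.id_apply]
      nlinarith [mul_nonneg (norm_nonneg (q p)) (sq_nonneg (‖y p.1‖ - ‖x p.2‖))])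
  -- `G` is nonnegative on `e` and on `-e` if `e` vanishes under all tests
  have hG0 : ∀ e : FormalMatrix L H, (∀ y x : H →ₗ[ℂ] L, value LinearMap.id y x e = 0) →
      G e = 0 := by
    intro e he
    refine le_antisymm ?_ (hGpos e fun y x => (he y x).ge)
    have := hGpos (-e) fun y x => by rw [map_neg, he, neg_zero]
    rw [map_neg] at this
    linarith
  have hGeq : ∀ e e' : FormalMatrix L H,
      (∀ y x : H →ₗ[ℂ] L, value LinearMap.id y x e = value LinearMap.id y x e') → G e = G e' := by
    intro e e' h
    rw [← sub_eq_zero, ← map_sub]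
    exact hG0 _ fun y x => by rw [map_sub, h, sub_self]
  -- the factor `2⁻¹` undoes the `2` in front of the corner in `FormalMatrix.value`
  obtain ⟨ψ, hψ, hcc⟩ := exists_completelyContractive_of_form (L := L) (H := H)
    (fun v η ξ => 2⁻¹ * G (Finsupp.single (η, ξ) v, 0))
    (fun v w η ξ => by
      rw [← mul_add, ← map_add]
      congr 1
      exact hGeq _ _ fun y x => by
        simp only [map_add, value_single_corner, LinearMap.id_apply, add_apply, inner_add_right,
          Complex.add_re]
        ring)
    (fun t v η ξ => by
      rw [mul_left_comm, ← smul_eq_mul t, ← map_smul]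
      congr 1
      exact hGeq _ _ fun y x => by
        simp only [map_smul, value_single_corner, LinearMap.id_apply, smul_apply, inner_smul_right,
          Complex.re_ofReal_mul, smul_eq_mul]
        ring)
    (fun v η η' ξ => by
      rw [← mul_add, ← map_add]
      congr 1
      exact hGeq _ _ fun y x => by
        simp only [map_add, value_single_corner, inner_add_left, Complex.add_re]
        ring)
    (fun c v η ξ => by
      congr 1
      exact hGeq _ _ fun y x => by
        simp only [map_smul, value_single_corner, LinearMap.id_apply, smul_apply, inner_smul_right,
          inner_smul_left])
    (fun v η ξ ξ' => by
      rw [← mul_add, ← map_add]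
      congr 1
      exact hGeq _ _ fun y x => by
        simp only [map_add, value_single_corner, inner_add_right, Complex.add_re]
        ring)
    (fun c v η ξ => by
      congr 1
      exact hGeq _ _ fun y x => by
        simp only [map_smul, value_single_corner, LinearMap.id_apply, smul_apply, inner_smul_right])
    (fun n a y x => by
      let e₂ : FormalMatrix L H := ∑ i, (0, Finsupp.single (y i) ‖matrixOp a‖, 0)
        + ∑ j, (0, 0, Finsupp.single (x j) ‖matrixOp a‖)
      let e₁ : FormalMatrix L H := ∑ i, ∑ j, (Finsupp.single (y i, x j) (a i j), 0)
      have hmem : e₂ - e₁ ∈ positiveCone L H := by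
        intro Y X
        have := (norm_matrixOp_le_iff (norm_nonneg (matrixOp a))).1 le_rfl
          (fun i => Y (y i)) (fun j => X (x j))
        simp only [e₁, e₂, map_sub, map_add, map_sum, value_single_left, value_single_right,
          value_single_corner, LinearMap.id_apply, ← Finset.mul_sum]
        linarith
      have h1 := hGpos _ hmem
      have h2 : e₂ ∈ D := by
        intro p
        simp [e₂, Prod.fst_sum]
      have h3 : G e₂ = ‖matrixOp a‖ * (∑ i, ‖y i‖ ^ 2 + ∑ j, ‖x j‖ ^ 2) := by
        refine (hGext ⟨e₂, h2⟩).trans ?_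
        change value T LinearMap.id LinearMap.id e₂ = _
        simp only [e₂, map_add, map_sum, value_single_left, value_single_right, LinearMap.id_apply,
          ← Finset.mul_sum]
        ring
      rw [map_sub, h3] at h1
      simp only [e₁, map_sum] at h1
      simp only [← Finset.mul_sum]
      linarith)
  refine ⟨ψ, hcc, fun v => ext_of_re_inner fun η ξ => ?_⟩
  have hmem : ((Finsupp.single (η, ξ) (v : L →L[ℂ] L), 0) : FormalMatrix L H) ∈ D := by
    intro p
    classical
    rw [Finsupp.single_apply]
    split_ifs
    exacts [v.2, A.zero_mem]
  have h1 : G (Finsupp.single (η, ξ) (v : L →L[ℂ] L), 0)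
      = value T LinearMap.id LinearMap.id (Finsupp.single (η, ξ) (v : L →L[ℂ] L), 0) :=
    hGext ⟨_, hmem⟩
  rw [hψ, h1, value_single_corner, hTφ']
  simp

end Extension

/-! ### The compact right topological semigroup of maps fixing `E` -/

section Compactness

variable {H : Type*} [NormedAddCommGroup H] [InnerProductSpace ℂ H]

theorem normalFunctional_add (x y : lp (fun _ : ℕ => H) 2) (a b : H →L[ℂ] H) :
    normalFunctional x y (a + b) = normalFunctional x y a + normalFunctional x y b := by
  simp only [normalFunctional, add_apply, inner_add_right]
  exact (summable_normalFunctional x y a).tsum_add (summable_normalFunctional x y b)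

theorem normalFunctional_smul (x y : lp (fun _ : ℕ => H) 2) (c : ℂ) (a : H →L[ℂ] H) :
    normalFunctional x y (c • a) = c * normalFunctional x y a := by
  simp only [normalFunctional, smul_apply, inner_smul_right, tsum_mul_left]

theorem normalFunctional_single (η ξ : H) (a : H →L[ℂ] H) :
    normalFunctional (lp.single 2 0 ξ) (lp.single 2 0 η) a = inner ℂ η (a ξ) := by
  rw [normalFunctional, tsum_eq_single 0]
  · simp
  · intro k hk
    simp [Pi.single_eq_of_ne hk]

variable (H) in
/-- The embedding that defines the topology of pointwise weak* convergence. -/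
noncomputable def weakStarCoordinates : Module.End ℂ (H →L[ℂ] H) →ₗ[ℝ]
    ((H →L[ℂ] H) × lp (fun _ : ℕ => H) 2 × lp (fun _ : ℕ => H) 2 → ℂ) where
  toFun φ p := normalFunctional p.2.1 p.2.2 (φ p.1)
  map_add' φ ψ := by
    ext p
    exact normalFunctional_add _ _ _ _
  map_smul' t φ := by
    ext p
    exact normalFunctional_smul _ _ (t : ℂ) _

theorem weakStarCoordinates_injective : Function.Injective (weakStarCoordinates H) := by
  intro φ ψ h
  refine LinearMap.ext fun a => ext_of_re_inner fun η ξ => ?_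
  have := congrFun h (a, lp.single 2 0 ξ, lp.single 2 0 η)
  simp only [weakStarCoordinates, LinearMap.coe_mk, AddHom.coe_mk, normalFunctional_single] at this
  rw [this]

variable (H) in
theorem isInducing_weakStarCoordinates :
    @Topology.IsInducing _ _ (pointwiseWeakStar H) _ (weakStarCoordinates H) :=
  @Topology.IsInducing.mk _ _ (pointwiseWeakStar H) _ _ rfl

theorem norm_inner_apply_le_of_mem_fixingMaps {E : Submodule ℂ (H →L[ℂ] H)}
    {φ : Module.End ℂ (H →L[ℂ] H)} (hφ : φ ∈ fixingMaps E) (a : H →L[ℂ] H) (η ξ : H) :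
    ‖inner ℂ η (φ a ξ)‖ ≤ ‖matrixOp (fun _ _ : Fin 1 => a)‖ * (‖η‖ * ‖ξ‖) := by
  refine norm_le_of_two_mul_re_le (s := fun η ξ => inner ℂ η (φ a ξ))
    (fun c y x => inner_smul_left _ _ _) (fun c y x => by rw [map_smul, inner_smul_right])
    (fun y x => ?_) η ξ
  have := (norm_matrixOp_le_iff (norm_nonneg (matrixOp fun _ _ : Fin 1 => a))).1
    (hφ.1 1 (fun _ _ : Fin 1 => a)) (fun _ => y) (fun _ => x)
  simpa [Matrix.map] using this

/-- Bounded sets of maps carry the same pointwise weak* and pointwise weak operator topology, and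
in the latter the maps in question form a closed subset of a product of intervals. -/
theorem isCompact_fixingMaps [CompleteSpace H] (E : Submodule ℂ (H →L[ℂ] H)) :
    @IsCompact _ (pointwiseWeakStar H) (fixingMaps E) := by
  let J : Module.End ℂ (H →L[ℂ] H) → ((H →L[ℂ] H) × H × H → ℝ) :=
    fun φ p => (inner ℂ p.2.1 (φ p.1 p.2.2)).re
  have hJ : Function.Injective J := fun φ ψ h =>
    LinearMap.ext fun a => ext_of_re_inner fun η ξ => congrFun h (a, η, ξ)
  have hclosed : IsClosed (J '' fixingMaps E) := by
    have : J '' fixingMaps E = {r |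
        (∀ a b η ξ, r (a + b, η, ξ) = r (a, η, ξ) + r (b, η, ξ)) ∧
        (∀ (t : ℝ) a η ξ, r ((t : ℂ) • a, η, ξ) = t * r (a, η, ξ)) ∧
        (∀ a η η' ξ, r (a, η + η', ξ) = r (a, η, ξ) + r (a, η', ξ)) ∧
        (∀ (c : ℂ) a η ξ, r (a, c • η, ξ) = r (conj c • a, η, ξ)) ∧
        (∀ a η ξ ξ', r (a, η, ξ + ξ') = r (a, η, ξ) + r (a, η, ξ')) ∧
        (∀ (c : ℂ) a η ξ, r (a, η, c • ξ) = r (c • a, η, ξ)) ∧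
        (∀ (n : ℕ) (a : Matrix (Fin n) (Fin n) (H →L[ℂ] H)) (y x : Fin n → H),
          2 * ∑ i, ∑ j, r (a i j, y i, x j)
            ≤ ‖matrixOp a‖ * (∑ i, ‖y i‖ ^ 2 + ∑ j, ‖x j‖ ^ 2)) ∧
        ∀ a ∈ E, ∀ η ξ, r (a, η, ξ) = (inner ℂ η (a ξ)).re} := by
      ext r
      constructor
      · rintro ⟨φ, hφ, rfl⟩
        refine ⟨fun a b η ξ => ?_, fun t a η ξ => ?_, fun a η η' ξ => ?_, fun c a η ξ => ?_,
          fun a η ξ ξ' => ?_, fun c a η ξ => ?_, fun n a y x => ?_, fun a ha η ξ => ?_⟩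
        · simp only [J, map_add, add_apply, inner_add_right, Complex.add_re]
        · simp only [J, map_smul, smul_apply, inner_smul_right, Complex.re_ofReal_mul]
        · simp only [J, inner_add_left, Complex.add_re]
        · simp only [J, map_smul, smul_apply, inner_smul_right, inner_smul_left]
        · simp only [J, map_add, inner_add_right, Complex.add_re]
        · simp only [J, map_smul, smul_apply, inner_smul_right]
        · exact (norm_matrixOp_le_iff (norm_nonneg (matrixOp a))).1 (hφ.1 n a) y x
        · simp only [J, hφ.2 a ha]
      · rintro ⟨h1, h2, h3, h4, h5, h6, h7, h8⟩
        obtain ⟨φ, hφ, hcc⟩ := exists_completelyContractive_of_form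
          (fun a η ξ => r (a, η, ξ)) h1 h2 h3 h4 h5 h6 h7
        refine ⟨φ, ⟨hcc, fun a ha => ext_of_re_inner fun η ξ => ?_⟩, ?_⟩
        · rw [hφ, h8 a ha]
        · ext p
          exact hφ _ _ _
    rw [this]
    simp only [Set.ofPred_and, Set.ofPred_forall]
    refine IsClosed.inter ?_ (IsClosed.inter ?_ (IsClosed.inter ?_ (IsClosed.inter ?_
      (IsClosed.inter ?_ (IsClosed.inter ?_ (IsClosed.inter ?_ ?_))))))
    all_goals repeat refine isClosed_iInter fun _ => ?_
    all_goals first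
      | exact isClosed_eq (by fun_prop) (by fun_prop)
      | exact isClosed_le (by fun_prop) (by fun_prop)
  have hcompact : IsCompact (J '' fixingMaps E) := by
    refine (isCompact_univ_pi fun p : (H →L[ℂ] H) × H × H => isCompact_Icc
      (a := -(‖matrixOp (fun _ _ : Fin 1 => p.1)‖ * (‖p.2.1‖ * ‖p.2.2‖)))
      (b := ‖matrixOp (fun _ _ : Fin 1 => p.1)‖ * (‖p.2.1‖ * ‖p.2.2‖))).of_isClosed_subset
        hclosed ?_
    rintro _ ⟨φ, hφ, rfl⟩ p -
    exact abs_le.1 ((Complex.abs_re_le_norm _).trans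
      (norm_inner_apply_le_of_mem_fixingMaps hφ p.1 p.2.1 p.2.2))
  have himage : Function.invFun J '' (J '' fixingMaps E) = fixingMaps E := by
    rw [Set.image_image]
    simp [Function.leftInverse_invFun hJ _]
  let := pointwiseWeakStar H
  rw [← himage]
  refine hcompact.image_of_continuousOn ?_
  rw [(isInducing_weakStarCoordinates H).continuousOn_iff, continuousOn_pi]
  rintro ⟨a, x, y⟩
  -- on the set in question the series defining a normal functional converges uniformly
  have hsum : Summable fun k => ‖matrixOp (fun _ _ : Fin 1 => a)‖ * (‖y k‖ * ‖x k‖) := by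
    refine Summable.mul_left _ ?_
    have hx : Summable fun k => ‖x k‖ ^ 2 := by
      simpa using (lp.memℓp x).summable (by norm_num)
    have hy : Summable fun k => ‖y k‖ ^ 2 := by
      simpa using (lp.memℓp y).summable (by norm_num)
    refine Summable.of_nonneg_of_le (fun k => by positivity) (fun k => ?_) (hy.add hx)
    nlinarith [sq_nonneg (‖y k‖ - ‖x k‖), sq_nonneg ‖y k‖, sq_nonneg ‖x k‖]
  refine continuousOn_tsum (fun k => ?_) hsum ?_
  · have : Set.EqOn (fun r => inner ℂ (y k) (Function.invFun J r a (x k)))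
        (fun r : (H →L[ℂ] H) × H × H → ℝ =>
          (r (a, y k, x k) + r (a, Complex.I • y k, x k) * Complex.I : ℂ)) (J '' fixingMaps E) := by
      rintro _ ⟨φ, -, rfl⟩
      simp only [Function.leftInverse_invFun hJ φ, J, inner_smul_left]
      apply Complex.ext <;> simp
    refine ContinuousOn.congr ?_ this
    fun_prop
  · rintro k _ ⟨φ, hφ, rfl⟩
    rw [Function.leftInverse_invFun hJ φ]
    exact norm_inner_apply_le_of_mem_fixingMaps hφ a _ _

theorem mul_mem_fixingMaps {E : Submodule ℂ (H →L[ℂ] H)} {φ ψ : Module.End ℂ (H →L[ℂ] H)}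
    (hφ : φ ∈ fixingMaps E) (hψ : ψ ∈ fixingMaps E) : φ * ψ ∈ fixingMaps E :=
  ⟨fun n a => (hφ.1 n (a.map ψ)).trans (hψ.1 n a), fun x hx => by
    rw [Module.End.mul_apply, hψ.2 x hx, hφ.2 x hx]⟩

theorem one_mem_fixingMaps (E : Submodule ℂ (H →L[ℂ] H)) : 1 ∈ fixingMaps E :=
  ⟨fun _ _ => le_rfl, fun _ _ => rfl⟩

theorem convex_fixingMaps (E : Submodule ℂ (H →L[ℂ] H)) : Convex ℝ (fixingMaps E) := by
  intro φ hφ ψ hψ s t hs ht hst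
  refine ⟨fun n a => (norm_matrixOp_le_iff (norm_nonneg (matrixOp a))).2 fun y x => ?_,
    fun x hx => ?_⟩
  · have h1 := (norm_matrixOp_le_iff (norm_nonneg (matrixOp a))).1 (hφ.1 n a) y x
    have h2 := (norm_matrixOp_le_iff (norm_nonneg (matrixOp a))).1 (hψ.1 n a) y x
    have h3 : ∀ i j, (inner ℂ (y i) ((a.map (s • φ + t • ψ)) i j (x j))).re
        = s * (inner ℂ (y i) (a.map φ i j (x j))).re
          + t * (inner ℂ (y i) (a.map ψ i j (x j))).re := by
      intro i j
      change (inner ℂ (y i) ((s : ℂ) • φ (a i j) (x j) + (t : ℂ) • ψ (a i j) (x j))).re = _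
      rw [inner_add_right, inner_smul_right, inner_smul_right]
      simp
    simp only [h3, Finset.sum_add_distrib, ← Finset.mul_sum]
    have h4 := mul_le_mul_of_nonneg_left h1 hs
    have h5 := mul_le_mul_of_nonneg_left h2 ht
    have h6 : ‖matrixOp a‖ * (∑ i, ‖y i‖ ^ 2 + ∑ j, ‖x j‖ ^ 2)
        = s * (‖matrixOp a‖ * (∑ i, ‖y i‖ ^ 2 + ∑ j, ‖x j‖ ^ 2))
          + t * (‖matrixOp a‖ * (∑ i, ‖y i‖ ^ 2 + ∑ j, ‖x j‖ ^ 2)) := by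
      rw [← add_mul, hst, one_mul]
    linarith
  · rw [LinearMap.add_apply, LinearMap.smul_apply, LinearMap.smul_apply, hφ.2 x hx, hψ.2 x hx,
      ← add_smul, hst, one_smul]

variable (H) in
theorem t2Space_pointwiseWeakStar : @T2Space _ (pointwiseWeakStar H) := by
  let := pointwiseWeakStar H
  exact T2Space.of_injective_continuous weakStarCoordinates_injective
    (isInducing_weakStarCoordinates H).continuous

theorem continuous_mul_right_pointwiseWeakStar (ψ : Module.End ℂ (H →L[ℂ] H)) :
    @Continuous _ _ (pointwiseWeakStar H) (pointwiseWeakStar H) (· * ψ) := by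
  let := pointwiseWeakStar H
  rw [(isInducing_weakStarCoordinates H).continuous_iff]
  refine continuous_pi fun p => ?_
  exact (continuous_apply (ψ p.1, p.2)).comp (isInducing_weakStarCoordinates H).continuous

theorem isCompactAffineRightTopologicalSemigroup_fixingMaps [CompleteSpace H]
    (E : Submodule ℂ (H →L[ℂ] H)) :
    IsCompactAffineRightTopologicalSemigroup (pointwiseWeakStar H) (fixingMaps E) where
  isTopologicalAddGroup := topologicalAddGroup_induced (weakStarCoordinates H)
  continuousSMul := continuousSMul_induced (weakStarCoordinates H)
  locallyConvexSpace := LocallyConvexSpace.induced (weakStarCoordinates H)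
  t2Space := t2Space_pointwiseWeakStar H
  nonempty := ⟨1, one_mem_fixingMaps E⟩
  convex := convex_fixingMaps E
  isCompact := isCompact_fixingMaps E
  mul_mem _ hs _ ht := mul_mem_fixingMaps hs ht
  continuousOn_mul_right t _ :=
    @Continuous.continuousOn _ _ (pointwiseWeakStar H) (pointwiseWeakStar H) _ _
      (continuous_mul_right_pointwiseWeakStar t)
  affine_mul_right t _ s _ s' _ a b _ _ _ := by
    rw [add_mul, smul_mul_assoc, smul_mul_assoc]

end Compactness

/-! ### Minimal idempotents -/

section MinimalIdempotents

/-- A compact right topological semigroup has a minimal idempotent: any idempotent of a minimal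
compact left ideal is one. -/
theorem exists_isMinimalIdempotent {M : Type*} [Semigroup M] [TopologicalSpace M] [T2Space M]
    (hM : ∀ r : M, Continuous (· * r)) {S : Set M} (hne : S.Nonempty) (hS : IsCompact S)
    (hmul : ∀ s ∈ S, ∀ t ∈ S, s * t ∈ S) : ∃ f, IsMinimalIdempotent S f := by
  let I : Set (Set M) := {N | N ⊆ S ∧ IsCompact N ∧ N.Nonempty ∧ ∀ s ∈ S, ∀ n ∈ N, s * n ∈ N}
  obtain ⟨N, ⟨hNS, hNc, hNne, hN⟩, hmin⟩ : ∃ N, Minimal (· ∈ I) N := by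
    refine zorn_superset I fun c hcI hc => ?_
    rcases c.eq_empty_or_nonempty with rfl | hcne
    · exact ⟨S, ⟨subset_rfl, hS, hne, hmul⟩, by simp⟩
    have hcl : ∀ N ∈ c, IsClosed N := fun N hN => (hcI hN).2.1.isClosed
    obtain ⟨N₀, hN₀⟩ := hcne
    refine ⟨⋂₀ c, ⟨(Set.sInter_subset_of_mem hN₀).trans (hcI hN₀).1, ?_, ?_, ?_⟩,
      fun N hN => Set.sInter_subset_of_mem hN⟩
    · exact (hcI hN₀).2.1.of_isClosed_subset (isClosed_sInter hcl) (Set.sInter_subset_of_mem hN₀)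
    · have : Nonempty c := ⟨⟨N₀, hN₀⟩⟩
      rw [Set.sInter_eq_iInter]
      refine IsCompact.nonempty_iInter_of_directed_nonempty_isCompact_isClosed _ ?_
        (fun N => (hcI N.2).2.2.1) (fun N => (hcI N.2).2.1) (fun N => hcl N N.2)
      exact DirectedOn.directed_val (IsChain.directedOn hc.symm)
    · intro s hs n hn N hN
      exact (hcI hN).2.2.2 s hs n (hn N hN)
  obtain ⟨f, hfN, hff⟩ := exists_idempotent_in_compact_subsemigroup hM N hNne hNc
    fun x hx y hy => hN x (hNS hx) y hy
  refine ⟨f, hNS hfN, hff, fun e heS hee hef hfe => ?_⟩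
  have hmem : ((· * e) '' S) ∈ I := by
    refine ⟨?_, hS.image (hM e), hne.image _, ?_⟩
    · rintro _ ⟨s, hs, rfl⟩
      exact hmul s hs e heS
    · rintro s hs _ ⟨t, ht, rfl⟩
      exact ⟨s * t, hmul s hs t ht, mul_assoc _ _ _⟩
  have hsub : ((· * e) '' S) ⊆ N := by
    rintro _ ⟨s, hs, rfl⟩
    have := hN (s * e) (hmul s hs e heS) f hfN
    rwa [mul_assoc, hef] at this
  obtain ⟨s, -, hs⟩ := hmin hmem hsub hfN
  change s * e = f at hs
  rw [← hfe, ← hs, mul_assoc, hee]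

end MinimalIdempotents

/-! ### Injective envelopes as ranges of minimal idempotents -/

section Envelopes

variable {H : Type u} [NormedAddCommGroup H] [InnerProductSpace ℂ H]

theorem le_range_of_mem_fixingMaps {E : Submodule ℂ (H →L[ℂ] H)} {φ : Module.End ℂ (H →L[ℂ] H)}
    (hφ : φ ∈ fixingMaps E) : E ≤ LinearMap.range φ :=
  fun x hx => ⟨x, hφ.2 x hx⟩

/-- The range of a completely contractive projection on `B(H)` inherits injectivity from
`B(H)`. -/
theorem isInjective_range [CompleteSpace H] {E : Submodule ℂ (H →L[ℂ] H)}
    {φ : Module.End ℂ (H →L[ℂ] H)} (hφ : φ ∈ fixingMaps E) (hidem : φ * φ = φ) :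
    IsInjective (LinearMap.range φ) := by
  intro L _ _ _ A B hAB θ hθ
  obtain ⟨ψ, hψ, hext⟩ := exists_completelyContractive_extension A
    ((LinearMap.range φ).subtype ∘ₗ θ) hθ
  refine ⟨φ.rangeRestrict ∘ₗ ψ ∘ₗ B.subtype, fun n a => ?_, fun x => Subtype.ext ?_⟩
  · exact (hφ.1 n ((a.map fun x => (x : L →L[ℂ] L)).map ψ)).trans (hψ n _)
  · obtain ⟨z, hz⟩ := (θ x).2
    have h1 : ψ x = φ z := (hext x).trans hz.symm
    change φ (ψ x) = θ x
    rw [h1, ← hz]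
    exact LinearMap.congr_fun hidem z

/-- An injective subspace of `B(H)` is the range of a completely contractive projection: extend
the identity map. -/
theorem exists_idempotent_of_isInjective [CompleteSpace H] {E F : Submodule ℂ (H →L[ℂ] H)}
    (hE : E ≤ F) (hF : IsInjective F) :
    ∃ ψ ∈ fixingMaps E, ψ * ψ = ψ ∧ LinearMap.range ψ = F := by
  obtain ⟨θ, hθ, hext⟩ := hF H F ⊤ le_top LinearMap.id fun _ _ => le_rfl
  let ψ : Module.End ℂ (H →L[ℂ] H) :=
    F.subtype ∘ₗ θ ∘ₗ (Submodule.topEquiv (R := ℂ) (M := H →L[ℂ] H)).symm.toLinearMap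
  have hfix : ∀ x ∈ F, ψ x = x := fun x hx => congrArg Subtype.val (hext ⟨x, hx⟩)
  have hmem : ∀ x, ψ x ∈ F := fun x => (θ _).2
  refine ⟨ψ, ⟨fun n a => hθ n (a.map fun x => ⟨x, trivial⟩), fun x hx => hfix x (hE hx)⟩,
    LinearMap.ext fun x => hfix _ (hmem x), le_antisymm ?_ fun x hx => ⟨x, hfix x hx⟩⟩
  rintro _ ⟨x, rfl⟩
  exact hmem x

/-- If `F₀` is injective with `E ⊆ F₀ ⊆ φ(B(H))` and `ψ` is a completely contractive projection
onto `F₀`, then `ψφ` is an idempotent below `φ`. -/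
theorem isInjectiveEnvelope_range [CompleteSpace H] {E : Submodule ℂ (H →L[ℂ] H)}
    {φ : Module.End ℂ (H →L[ℂ] H)} (hφ : IsMinimalIdempotent (fixingMaps E) φ) :
    IsInjectiveEnvelope E (LinearMap.range φ)
      (Submodule.inclusion (le_range_of_mem_fixingMaps hφ.mem)) where
  completelyIsometric _ _ := rfl
  injective := isInjective_range hφ.mem hφ.idem
  minimal F₀ hE hF₀ hinj := by
    refine le_antisymm hF₀ ?_
    obtain ⟨ψ, hψ, hψψ, rfl⟩ := exists_idempotent_of_isInjective (fun x hx => hE ⟨x, hx⟩) hinj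
    have hφψ : φ * ψ = ψ := by
      refine LinearMap.ext fun x => ?_
      obtain ⟨z, hz⟩ := hF₀ ⟨x, rfl⟩
      rw [Module.End.mul_apply, ← hz]
      exact LinearMap.congr_fun hφ.idem z
    have h := hφ.minimal (ψ * φ) (mul_mem_fixingMaps hψ hφ.mem)
      (by rw [mul_assoc, ← mul_assoc φ, hφψ, ← mul_assoc, hψψ])
      (by rw [mul_assoc, hφ.idem]) (by rw [← mul_assoc, hφψ])
    rw [← h]
    exact LinearMap.range_comp_le_range φ ψ

/-- An idempotent `e` below a projection `ψ` onto an injective envelope has an injective range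
between `E` and the envelope, hence the same range as `ψ`, so that `e = eψ = ψ`. -/
theorem exists_isMinimalIdempotent_range_eq [CompleteSpace H] {E F : Submodule ℂ (H →L[ℂ] H)}
    (hE : E ≤ F) (hF : IsInjectiveEnvelope E F (Submodule.inclusion hE)) :
    ∃ φ, IsMinimalIdempotent (fixingMaps E) φ ∧ LinearMap.range φ = F := by
  obtain ⟨ψ, hψ, hψψ, hrange⟩ := exists_idempotent_of_isInjective hE hF.injective
  refine ⟨ψ, ⟨hψ, hψψ, fun e he hee heψ hψe => ?_⟩, hrange⟩
  have hsub : LinearMap.range e ≤ F := by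
    rw [← hψe, ← hrange]
    exact LinearMap.range_comp_le_range e ψ
  have heF := hF.minimal _ (fun x => le_range_of_mem_fixingMaps he x.2) hsub
    (isInjective_range he hee)
  rw [← heψ]
  refine LinearMap.ext fun x => ?_
  obtain ⟨z, hz⟩ : ψ x ∈ LinearMap.range e := by
    rw [heF, ← hrange]
    exact ⟨x, rfl⟩
  rw [Module.End.mul_apply, ← hz]
  exact LinearMap.congr_fun hee z

theorem exists_isMinimalIdempotent_fixingMaps [CompleteSpace H] (E : Submodule ℂ (H →L[ℂ] H)) :
    ∃ φ, IsMinimalIdempotent (fixingMaps E) φ := by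
  let := pointwiseWeakStar H
  have := t2Space_pointwiseWeakStar H
  exact exists_isMinimalIdempotent continuous_mul_right_pointwiseWeakStar
    ⟨1, one_mem_fixingMaps E⟩ (isCompact_fixingMaps E) fun _ hs _ ht => mul_mem_fixingMaps hs ht

end Envelopes

end InjectiveEnvelope

theorem mainTheorem1 {H : Type u} [NormedAddCommGroup H] [InnerProductSpace ℂ H] [CompleteSpace H]
    (E : Submodule ℂ (H →L[ℂ] H)) :
    InjectiveEnvelope.HasInjectiveEnvelope E ∧
    InjectiveEnvelope.IsCompactAffineRightTopologicalSemigroup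
      (InjectiveEnvelope.pointwiseWeakStar H) (InjectiveEnvelope.fixingMaps E) ∧
    (∃ φ, InjectiveEnvelope.IsMinimalIdempotent (InjectiveEnvelope.fixingMaps E) φ) ∧
    (∀ φ, InjectiveEnvelope.IsMinimalIdempotent (InjectiveEnvelope.fixingMaps E) φ →
      ∃ hE : E ≤ LinearMap.range φ, InjectiveEnvelope.IsInjectiveEnvelope E (LinearMap.range φ)
        (Submodule.inclusion hE)) ∧
    (∀ (F : Submodule ℂ (H →L[ℂ] H)) (hE : E ≤ F),
      InjectiveEnvelope.IsInjectiveEnvelope E F (Submodule.inclusion hE) →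
      ∃ φ, InjectiveEnvelope.IsMinimalIdempotent (InjectiveEnvelope.fixingMaps E) φ ∧
        LinearMap.range φ = F) := by
  obtain ⟨φ, hφ⟩ := InjectiveEnvelope.exists_isMinimalIdempotent_fixingMaps E
  exact ⟨⟨H, _, _, inferInstance, _, _, InjectiveEnvelope.isInjectiveEnvelope_range hφ⟩,
    InjectiveEnvelope.isCompactAffineRightTopologicalSemigroup_fixingMaps E, ⟨φ, hφ⟩,
    fun φ hφ => ⟨InjectiveEnvelope.le_range_of_mem_fixingMaps hφ.mem,
      InjectiveEnvelope.isInjectiveEnvelope_range hφ⟩,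
    fun F hE hF => InjectiveEnvelope.exists_isMinimalIdempotent_range_eq hE hF⟩
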